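/- All groups are abelian. A group $G$ is slender if it is torsion-free and, for every homomorphism $h:\mathbb Z^{\omega}\to G$, $h(e_n)=0$ for all but finitely many $n\in\mathbb N$, where $e_n\in\mathbb Z^\omega$ is the $n$-th standard unit vector. Let $L$ be the vocabulary of groups, consisting of a binary function symbol $+$ and a constant $0$. For infinite cardinals $\lambda\le\kappa$, $L_{\kappa\lambda}$ is the smallest collection of formulas that contains the atomic $L$-formulas and is closed under negation, under conjunctions and disjunctions of fewer than $\kappa$ formulas, and under existential and universal quantifier strings of length less than $\lambda$; $L_{\infty\lambda}$ is the union of the $L_{\kappa\lambda}$ over all infinite $\kappa\ge\lambda$. **Theorem.** There is a single sentence $\Phi$ of $L_{(2^{\aleph_0})^+\,\aleph_1}$ such that for every abelian group $G$, $G$ is slender if and only if $G\models\Phi$. Hence the class of slender abelian groups is axiomatizable in $L_{\infty\omega_1}$: it is the class of all models, among abelian groups, of some sentence of $L_{\infty\omega_1}$. -/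

import Mathlib

universe u u' v w

/-- Formulas of the infinitary logic over a vocabulary `L`, with free variables from `α`.
Conjunctions and disjunctions are taken over arbitrary families of formulas; a quantifier
string `ex ι`, `all ι` binds at once one fresh variable for each element of `ι`. -/
inductive InfFormula (L : FirstOrder.Language.{u, u'}) : Type w → Type (max u u' (w + 1))
  | equal {α : Type w} (t₁ t₂ : L.Term α) : InfFormula L α
  | rel {α : Type w} {n : ℕ} (R : L.Relations n) (ts : Fin n → L.Term α) : InfFormula L α
  | neg {α : Type w} (φ : InfFormula L α) : InfFormula L α
  | conj {α : Type w} (ι : Type w) (φ : ι → InfFormula L α) : InfFormula L α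
  | disj {α : Type w} (ι : Type w) (φ : ι → InfFormula L α) : InfFormula L α
  | ex {α : Type w} (ι : Type w) (φ : InfFormula L (α ⊕ ι)) : InfFormula L α
  | all {α : Type w} (ι : Type w) (φ : InfFormula L (α ⊕ ι)) : InfFormula L α

namespace InfFormula

variable {L : FirstOrder.Language.{u, u'}}

/-- `φ` belongs to `L_{κμ}`: conjunctions and disjunctions of fewer than `κ` formulas,
quantifier strings of length less than `μ`. -/
def InLogic (κ μ : Cardinal.{w}) : {α : Type w} → InfFormula L α → Prop
  | _, .equal _ _ => True
  | _, .rel _ _ => True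
  | _, .neg φ => φ.InLogic κ μ
  | _, .conj ι φ => Cardinal.mk ι < κ ∧ ∀ i, (φ i).InLogic κ μ
  | _, .disj ι φ => Cardinal.mk ι < κ ∧ ∀ i, (φ i).InLogic κ μ
  | _, .ex ι φ => Cardinal.mk ι < μ ∧ φ.InLogic κ μ
  | _, .all ι φ => Cardinal.mk ι < μ ∧ φ.InLogic κ μ

/-- Tarskian truth of a formula in the `L`-structure `M` under an assignment of its free
variables. -/
def Realize (M : Type v) [L.Structure M] : {α : Type w} → InfFormula L α → (α → M) → Prop
  | _, .equal t₁ t₂, s => t₁.realize s = t₂.realize s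
  | _, .rel R ts, s => FirstOrder.Language.Structure.RelMap R fun i => (ts i).realize s
  | _, .neg φ, s => ¬ φ.Realize M s
  | _, .conj _ φ, s => ∀ i, (φ i).Realize M s
  | _, .disj _ φ, s => ∃ i, (φ i).Realize M s
  | _, .ex ι φ, s => ∃ b : ι → M, φ.Realize M (Sum.elim s b)
  | _, .all ι φ, s => ∀ b : ι → M, φ.Realize M (Sum.elim s b)

end InfFormula

/-- Infinitary sentences: formulas without free variables. -/
abbrev InfSentence (L : FirstOrder.Language.{u, u'}) : Type (max u u' (w + 1)) :=
  InfFormula.{u, u', w} L PEmpty.{w + 1}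

/-- The sentence `Φ` holds in the structure `M`. -/
def InfSentence.Holds {L : FirstOrder.Language.{u, u'}} (Φ : InfSentence.{u, u', w} L)
    (M : Type v) [L.Structure M] : Prop :=
  InfFormula.Realize M Φ PEmpty.elim

/-- The function symbols of the vocabulary of groups: a constant `0` and a binary `+`. -/
inductive GroupFunc : ℕ → Type
  | zero : GroupFunc 0
  | add : GroupFunc 2

/-- The vocabulary of (abelian) groups. -/
def groupVocabulary : FirstOrder.Language.{0, 0} where
  Functions := GroupFunc
  Relations := fun _ => Empty

/-- An abelian group as a structure for the vocabulary of groups. -/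
instance groupVocabularyStructure (G : Type v) [AddCommGroup G] :
    groupVocabulary.Structure G where
  funMap := fun {_} f x => match f, x with
    | .zero, _ => 0
    | .add, x => x 0 + x 1
  RelMap := fun {_} R _ => nomatch R

/-- A class `C` of abelian groups is axiomatizable in `L_{∞μ}`: for some sentence of some
`L_{κμ}`, with `κ ≥ μ` infinite, `C` is exactly the class of its models. -/
def IsAxiomatizable (μ : Cardinal.{w}) (C : (G : Type v) → [AddCommGroup G] → Prop) : Prop :=
  ∃ κ : Cardinal.{w}, Cardinal.aleph0 ≤ κ ∧ μ ≤ κ ∧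
    ∃ Φ : InfSentence.{0, 0, w} groupVocabulary, Φ.InLogic κ μ ∧
      ∀ (G : Type v) [AddCommGroup G], C G ↔ Φ.Holds G

/-- An abelian group `G` is slender if it is torsion-free and every homomorphism
`ℤ^ω → G` kills all but finitely many of the standard unit vectors. -/
def IsSlender (G : Type v) [AddCommGroup G] : Prop :=
  IsAddTorsionFree G ∧
    ∀ h : (ℕ → ℤ) →+ G, {n : ℕ | h (Pi.single n 1) ≠ 0}.Finite

/-! Slenderness quantifies over homomorphisms on `ℤ^ω`, which are too large for a countable
quantifier string. It is traded for a condition on the sequence `g n = h(e_n)` alone. The tail of `∑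
n! a n • e_n` from `N` on is divisible by `N!`, so `h` yields sums of all series `∑ n! a n • g n`.
Conversely, if only zero is divisible by all factorials, such sums are unique, hence additive in
`a`, and define a homomorphism with `e_n ↦ n! • g n`; torsion-freeness keeps these values nonzero. A
slender group has no nonzero element divisible by all factorials, since otherwise `ℚ` would map
nontrivially into it. The coefficient sequences are handled by a conjunction of size `2^ℵ₀`, not by
a quantifier. -/

/-- A hom `ℤ^ω → G` into a group with a nonzero element that is divisible by every factorial
can be nonzero at all the unit vectors. -/
theorem exists_addMonoidHom_single_ne_zero_of_factorial_dvd {G : Type v} [AddCommGroup G]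
    [IsAddTorsionFree G] {x : G} (hx : x ≠ 0) (hdiv : ∀ N : ℕ, ∃ z : G, x = N.factorial • z) :
    ∃ h : (ℕ → ℤ) →+ G, ∀ n, h (Pi.single n 1) ≠ 0 := by
  have inj : ∀ {n : ℕ} {a b : G}, n ≠ 0 → n • a = n • b → a = b := fun hn hab =>
    nsmul_right_injective hn hab
  -- The element `y` plays the role of `q • x`; it exists because `q.den` divides `q.den!`.
  have key : ∀ q : ℚ, ∃ y : G, (q.den : ℤ) • y = q.num • x := by
    intro q
    obtain ⟨z, hz⟩ := hdiv q.den
    obtain ⟨c, hc⟩ := Nat.dvd_factorial q.pos le_rfl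
    refine ⟨q.num • c • z, ?_⟩
    rw [smul_comm, hz, hc, mul_smul, natCast_zsmul]
  choose φ hφ using key
  -- The value `φ q` can be tested against any multiple `m` clearing the denominator; this makes `φ`
  -- additive.
  have cross : ∀ (q : ℚ) (m : ℕ) (k : ℤ), q * m = k → m • φ q = k • x := by
    intro q m k hk
    have h1 : q.num * (m : ℤ) = k * q.den := by
      have h2 : (q.num : ℚ) = q * q.den := (Rat.mul_den_eq_num q).symm
      have h3 : ((q.num * (m : ℤ) : ℤ) : ℚ) = ((k * q.den : ℤ) : ℚ) := by
        push_cast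
        rw [h2, ← hk]
        ring
      exact_mod_cast h3
    apply inj q.den_nz
    rw [smul_comm, ← natCast_zsmul (φ q), hφ, ← natCast_zsmul, smul_smul, mul_comm, h1,
      ← natCast_zsmul, smul_smul, mul_comm]
  let Φ : ℚ →+ G := AddMonoidHom.mk' φ (by
    intro p q
    apply inj (mul_ne_zero p.den_nz q.den_nz)
    have hp := Rat.mul_den_eq_num p
    have hq := Rat.mul_den_eq_num q
    rw [smul_add, cross p _ (p.num * q.den) (by push_cast; rw [← hp]; ring),
      cross q _ (q.num * p.den) (by push_cast; rw [← hq]; ring),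
      cross (p + q) _ (p.num * q.den + q.num * p.den)
        (by push_cast; rw [← hp, ← hq]; ring), add_smul])
  have hΦ : Φ 1 ≠ 0 := by
    have h1 : φ 1 = x := by simpa using cross 1 1 1 (by simp)
    simpa [Φ, h1] using hx
  -- The sum of coefficients on finitely supported sequences, extended to all of `ℚ^ω` by a linear
  -- retraction.
  obtain ⟨F, hF⟩ : ∃ F : (ℕ → ℚ) →ₗ[ℚ] ℚ, ∀ n, F (Pi.single n 1) = 1 := by
    obtain ⟨P, hP⟩ := LinearMap.exists_leftInverse_of_injective
      (Finsupp.lcoeFun : (ℕ →₀ ℚ) →ₗ[ℚ] ℕ → ℚ) (LinearMap.ker_eq_bot.2 DFunLike.coe_injective)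
    refine ⟨(Finsupp.linearCombination ℚ fun _ => 1) ∘ₗ P, fun n => ?_⟩
    have h := LinearMap.congr_fun hP (Finsupp.single n 1)
    simp only [LinearMap.comp_apply, Finsupp.lcoeFun_apply, Finsupp.single_eq_pi_single,
      LinearMap.id_apply] at h
    rw [LinearMap.comp_apply, h]
    simp
  let c : (ℕ → ℤ) →+ (ℕ → ℚ) :=
    AddMonoidHom.mk' (fun a n => (a n : ℚ)) (fun a b => by ext n; simp)
  refine ⟨Φ.comp (F.toAddMonoidHom.comp c), fun n => ?_⟩
  have hc : c (Pi.single n 1) = Pi.single n 1 := by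
    ext k
    by_cases hk : k = n
    · subst hk; simp [c]
    · simp [c, hk]
  simpa [hc, hF] using hΦ

/-! ### Series in the topology of divisibility -/

/-- The element `y` is, for the topology of divisibility, the sum of the series
`∑ n! a n • g n`. -/
def IsFactorialSum {G : Type v} [AddCommGroup G] (g : ℕ → G) (a : ℕ → ℤ) (y : G) : Prop :=
  ∀ N : ℕ, ∃ z : G,
    y = ∑ n ∈ Finset.range N, ((n.factorial : ℤ) * a n) • g n + N.factorial • z

namespace IsFactorialSum

variable {G : Type v} [AddCommGroup G] {g : ℕ → G} {a b : ℕ → ℤ} {y z : G}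

theorem add (hy : IsFactorialSum g a y) (hz : IsFactorialSum g b z) :
    IsFactorialSum g (a + b) (y + z) := by
  intro N
  obtain ⟨u, hu⟩ := hy N
  obtain ⟨w, hw⟩ := hz N
  refine ⟨u + w, ?_⟩
  rw [hu, hw]
  simp only [Pi.add_apply, mul_add, add_smul, Finset.sum_add_distrib, smul_add]
  abel

theorem neg (hy : IsFactorialSum g a y) : IsFactorialSum g (-a) (-y) := by
  intro N
  obtain ⟨u, hu⟩ := hy N
  refine ⟨-u, ?_⟩
  rw [hu]
  simp only [Pi.neg_apply, mul_neg, neg_smul, Finset.sum_neg_distrib, smul_neg]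
  abel

/-- The difference of two sums is a sum of the zero series, so every factorial divides it. -/
theorem unique (hred : ∀ x : G, (∀ N : ℕ, ∃ z : G, x = N.factorial • z) → x = 0)
    (hy : IsFactorialSum g a y) (hz : IsFactorialSum g a z) : y = z := by
  rw [← sub_eq_zero]
  refine hred _ fun N => ?_
  obtain ⟨u, hu⟩ := (hy.add hz.neg) N
  exact ⟨u, by simpa [sub_eq_add_neg] using hu⟩

theorem single (g : ℕ → G) (k : ℕ) :
    IsFactorialSum g (Pi.single k 1) (k.factorial • g k) := by
  intro N
  by_cases hk : k < N
  · refine ⟨0, ?_⟩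
    rw [Finset.sum_eq_single_of_mem k (Finset.mem_range.2 hk)]
    · simp
    · intro b _ hb
      simp [hb]
  · obtain ⟨c, hc⟩ := Nat.factorial_dvd_factorial (not_lt.1 hk)
    refine ⟨c • g k, ?_⟩
    rw [Finset.sum_eq_zero, hc, mul_smul, zero_add]
    intro b hb
    have : b ≠ k := by
      have := Finset.mem_range.1 hb
      omega
    simp [this]

/-- A homomorphism defined on `ℤ^ω` respects series whose coefficients are divisible by
the factorials. -/
theorem map (h : (ℕ → ℤ) →+ G) (a : ℕ → ℤ) :
    IsFactorialSum (fun n => h (Pi.single n 1)) a (h fun n => (n.factorial : ℤ) * a n) := by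
  intro N
  -- The tail of the series divided by `N!`; the natural division is exact for `n ≥ N`.
  refine ⟨h fun n => if n < N then 0 else ((n.factorial / N.factorial : ℕ) : ℤ) * a n, ?_⟩
  rw [← map_nsmul]
  simp only [← map_zsmul]
  rw [← map_sum, ← map_add]
  congr 1
  ext k
  simp only [Pi.add_apply, Finset.sum_apply, Pi.smul_apply, smul_eq_mul, nsmul_eq_mul,
    Pi.single_apply]
  by_cases hk : k < N
  · rw [Finset.sum_eq_single_of_mem k (Finset.mem_range.2 hk)]
    · simp [hk]
    · intro b _ hb
      simp [hb.symm]
  · rw [Finset.sum_eq_zero]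
    · have hd : N.factorial * (k.factorial / N.factorial) = k.factorial :=
        Nat.mul_div_cancel' (Nat.factorial_dvd_factorial (not_lt.1 hk))
      rw [zero_add, Pi.mul_apply, if_neg hk, Pi.natCast_apply, ← mul_assoc, ← Nat.cast_mul, hd]
    · intro b hb
      have : k ≠ b := by
        have := Finset.mem_range.1 hb
        omega
      simp [this]

end IsFactorialSum

/-- In a torsion-free reduced group, if all the series `∑ n! a n • g n` have sums then some
homomorphism from `ℤ^ω` sends the unit vectors to the elements `n! • g n`. -/
theorem exists_addMonoidHom_of_isFactorialSum {G : Type v} [AddCommGroup G]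
    (hred : ∀ x : G, (∀ N : ℕ, ∃ z : G, x = N.factorial • z) → x = 0) {g : ℕ → G}
    (hg : ∀ a : ℕ → ℕ, ∃ y, IsFactorialSum g (fun n => (a n : ℤ)) y) :
    ∃ h : (ℕ → ℤ) →+ G, ∀ n, h (Pi.single n 1) = n.factorial • g n := by
  have hg' : ∀ a : ℕ → ℤ, ∃ y, IsFactorialSum g a y := by
    intro a
    -- Split `a` into positive and negative parts. Natural coefficients suffice, which suits a
    -- vocabulary without negation.
    obtain ⟨y, hy⟩ := hg fun n => (a n).toNat
    obtain ⟨z, hz⟩ := hg fun n => (-a n).toNat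
    refine ⟨y + -z, ?_⟩
    convert hy.add hz.neg using 1
    ext n
    simp only [Pi.add_apply, Pi.neg_apply]
    omega
  choose φ hφ using hg'
  exact ⟨AddMonoidHom.mk' φ fun a b => (hφ (a + b)).unique hred ((hφ a).add (hφ b)),
    fun n => (hφ _).unique hred (.single g n)⟩

/-- A characterization of slender groups which mentions only countably many elements at a
time. -/
theorem isSlender_iff (G : Type v) [AddCommGroup G] :
    IsSlender G ↔
      (∀ (n : ℕ) (x : G), (n + 1) • x = 0 → x = 0) ∧
      (∀ x : G, (∀ N : ℕ, ∃ z : G, x = N.factorial • z) → x = 0) ∧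
      ¬ ∃ g : ℕ → G, (∀ n, ∃ m, g (n + m) ≠ 0) ∧
        ∀ a : ℕ → ℕ, ∃ y, IsFactorialSum g (fun n => (a n : ℤ)) y := by
  constructor
  · rintro ⟨htf, hfin⟩
    have hred : ∀ x : G, (∀ N : ℕ, ∃ z : G, x = N.factorial • z) → x = 0 := by
      intro x hdiv
      by_contra hx
      obtain ⟨h, hh⟩ := exists_addMonoidHom_single_ne_zero_of_factorial_dvd hx hdiv
      have := hfin h
      simp only [hh, ne_eq, not_false_eq_true, Set.ofPred_true] at this
      exact Set.infinite_univ this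
    refine ⟨fun n x hx => (nsmul_eq_zero_iff_right n.succ_ne_zero).1 hx, hred, ?_⟩
    rintro ⟨g, hne, hg⟩
    obtain ⟨h, hh⟩ := exists_addMonoidHom_of_isFactorialSum hred hg
    obtain ⟨B, hB⟩ := (hfin h).bddAbove
    obtain ⟨m, hm⟩ := hne (B + 1)
    have hle : B + 1 + m ≤ B := hB (by
      rw [Set.mem_ofPred_eq, hh]
      exact fun h0 => hm ((nsmul_eq_zero_iff_right (Nat.factorial_ne_zero _)).1 h0))
    omega
  · rintro ⟨htf, -, hno⟩
    refine ⟨⟨fun n hn x y hxy => ?_⟩, fun h => ?_⟩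
    · obtain ⟨k, rfl⟩ := Nat.exists_eq_succ_of_ne_zero hn
      exact sub_eq_zero.1 (htf k _ (by rw [smul_sub, sub_eq_zero]; exact hxy))
    · by_contra hinf
      refine hno ⟨fun n => h (Pi.single n 1), fun n => ?_, fun a => ⟨_, .map h _⟩⟩
      obtain ⟨k, hk, hnk⟩ := Set.Infinite.exists_gt hinf n
      exact ⟨k - n, by rwa [Nat.add_sub_cancel' hnk.le]⟩

/-! ### Terms of the vocabulary of groups -/

namespace GroupTerm

open FirstOrder

/-- The term `0`. -/
def zero {α : Type w} : groupVocabulary.Term α :=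
  .func (show groupVocabulary.Functions 0 from GroupFunc.zero) Fin.elim0

/-- The term `s + t`. -/
def add {α : Type w} (s t : groupVocabulary.Term α) : groupVocabulary.Term α :=
  .func (show groupVocabulary.Functions 2 from GroupFunc.add) ![s, t]

/-- The term `t + ⋯ + t` with `n` summands. -/
def nsmul {α : Type w} (n : ℕ) (t : groupVocabulary.Term α) : groupVocabulary.Term α :=
  Nat.rec zero (fun _ s => add s t) n

/-- The term `t 0 + ⋯ + t (N - 1)`. -/
def sum {α : Type w} (t : ℕ → groupVocabulary.Term α) (N : ℕ) : groupVocabulary.Term α :=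
  Nat.rec zero (fun n s => add s (t n)) N

variable {G : Type v} [AddCommGroup G] {α : Type w} (v : α → G)

@[simp]
theorem realize_zero : (zero : groupVocabulary.Term α).realize v = 0 := rfl

@[simp]
theorem realize_add (s t : groupVocabulary.Term α) :
    (add s t).realize v = s.realize v + t.realize v := rfl

@[simp]
theorem realize_nsmul (n : ℕ) (t : groupVocabulary.Term α) :
    (nsmul n t).realize v = n • t.realize v := by
  induction n with
  | zero => simp [nsmul]
  | succ n ih => rw [succ_nsmul, ← ih]; rfl

@[simp]
theorem realize_sum (t : ℕ → groupVocabulary.Term α) (N : ℕ) :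
    (sum t N).realize v = ∑ n ∈ Finset.range N, (t n).realize v := by
  induction N with
  | zero => simp [sum]
  | succ n ih => rw [Finset.sum_range_succ, ← ih]; rfl

end GroupTerm

/-! ### The infinitary sentence -/

namespace InfFormula

/-- The conjunction of two formulas. -/
def and {L : FirstOrder.Language.{u, u'}} {α : Type} (φ ψ : InfFormula L α) : InfFormula L α :=
  .conj Bool fun b => cond b φ ψ

/-- The implication between two formulas. -/
def imp {L : FirstOrder.Language.{u, u'}} {α : Type} (φ ψ : InfFormula L α) : InfFormula L α :=
  .disj Bool fun b => cond b φ.neg ψ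

section Logic

variable {L : FirstOrder.Language.{u, u'}} {α : Type} {φ ψ : InfFormula L α}

theorem realize_and {M : Type v} [L.Structure M] {s : α → M} :
    (φ.and ψ).Realize M s ↔ φ.Realize M s ∧ ψ.Realize M s := by
  simp [and, Realize, and_comm]

theorem realize_imp {M : Type v} [L.Structure M] {s : α → M} :
    (φ.imp ψ).Realize M s ↔ (φ.Realize M s → ψ.Realize M s) := by
  simp [imp, Realize, or_comm, imp_iff_not_or]

theorem InLogic.and {κ μ : Cardinal} (hκ : Cardinal.aleph0 ≤ κ) (hφ : φ.InLogic κ μ)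
    (hψ : ψ.InLogic κ μ) : (φ.and ψ).InLogic κ μ :=
  ⟨(Cardinal.lt_aleph0_of_finite Bool).trans_le hκ, by rintro (_ | _) <;> assumption⟩

theorem InLogic.imp {κ μ : Cardinal} (hκ : Cardinal.aleph0 ≤ κ) (hφ : φ.InLogic κ μ)
    (hψ : ψ.InLogic κ μ) : (φ.imp ψ).InLogic κ μ :=
  ⟨(Cardinal.lt_aleph0_of_finite Bool).trans_le hκ, by rintro (_ | _) <;> assumption⟩

end Logic

/-- The sentence saying that there is no torsion. -/
def torsionFree : InfSentence.{0, 0, 0} groupVocabulary :=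
  .conj ℕ fun n => .all Unit <|
    imp (.equal (GroupTerm.nsmul (n + 1) (.var (.inr ()))) GroupTerm.zero)
      (.equal (.var (.inr ())) GroupTerm.zero)

/-- The sentence saying that only zero is divisible by all the factorials. -/
def reduced : InfSentence.{0, 0, 0} groupVocabulary :=
  .all Unit <|
    imp (.conj ℕ fun N => .ex Unit <|
        .equal (.var (.inl (.inr ()))) (GroupTerm.nsmul N.factorial (.var (.inr ()))))
      (.equal (.var (.inr ())) GroupTerm.zero)

/-- The sentence saying that, for some sequence `g` with infinitely many nonzero terms, all
the series `∑ n! a n • g n` with natural numbers `a n` have sums. -/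
def hasFactorialSums : InfSentence.{0, 0, 0} groupVocabulary :=
  .ex ℕ <| and
    (.conj ℕ fun n => .disj ℕ fun m =>
      .neg (.equal (.var (.inr (n + m))) GroupTerm.zero))
    (.conj (ℕ → ℕ) fun a => .ex Unit <| .conj ℕ fun N => .ex Unit <|
      .equal (.var (.inl (.inr ())))
        (GroupTerm.add
          (GroupTerm.sum (fun n => GroupTerm.nsmul (n.factorial * a n)
            (.var (.inl (.inl (.inr n))))) N)
          (GroupTerm.nsmul N.factorial (.var (.inr ())))))

/-- A sentence whose models among the abelian groups are the slender groups. -/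
def slender : InfSentence.{0, 0, 0} groupVocabulary :=
  torsionFree.and (reduced.and hasFactorialSums.neg)

theorem slender_inLogic :
    slender.InLogic (Order.succ ((2 : Cardinal.{0}) ^ Cardinal.aleph0)) (Cardinal.aleph 1) := by
  have hκ : Cardinal.aleph0 < Order.succ ((2 : Cardinal.{0}) ^ Cardinal.aleph0) :=
    (Cardinal.cantor _).trans (Order.lt_succ _)
  have hN : Cardinal.mk ℕ < Order.succ ((2 : Cardinal.{0}) ^ Cardinal.aleph0) := by
    rwa [Cardinal.mk_nat]
  have hN' : Cardinal.mk ℕ < Cardinal.aleph 1 := by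
    rw [Cardinal.mk_nat]; exact Cardinal.aleph0_lt_aleph_one
  have hU : Cardinal.mk Unit < Cardinal.aleph 1 :=
    (Cardinal.lt_aleph0_of_finite Unit).trans Cardinal.aleph0_lt_aleph_one
  -- The only uncountable conjunction: `ℵ₀ ^ ℵ₀ = 2 ^ ℵ₀` is what forces the successor in the bound.
  have hNN : Cardinal.mk (ℕ → ℕ) < Order.succ ((2 : Cardinal.{0}) ^ Cardinal.aleph0) := by
    rw [Order.lt_succ_iff, ← Cardinal.power_def, Cardinal.mk_nat,
      Cardinal.power_self_eq le_rfl]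
  refine .and hκ.le ⟨hN, fun n => ⟨hU, .imp hκ.le trivial trivial⟩⟩
    (.and hκ.le ⟨hU, .imp hκ.le ⟨hN, fun N => ⟨hU, trivial⟩⟩ trivial⟩ ?_)
  exact ⟨hN', .and hκ.le ⟨hN, fun n => ⟨hN, fun m => trivial⟩⟩
    ⟨hNN, fun a => ⟨hU, hN, fun N => ⟨hU, trivial⟩⟩⟩⟩

theorem holds_slender_iff (G : Type v) [AddCommGroup G] :
    InfSentence.Holds slender G ↔ IsSlender G := by
  -- Quantifier strings of length one range over functions on `Unit`; these are replaced by
  -- elements.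
  have huniq : ∀ p : (Unit → G) → Prop, (∃ b, p b) ↔ ∃ x, p fun _ => x := fun p =>
    ⟨fun ⟨b, hb⟩ => ⟨b (), hb⟩, fun ⟨x, hx⟩ => ⟨_, hx⟩⟩
  have huniq' : ∀ p : (Unit → G) → Prop, (∀ b, p b) ↔ ∀ x, p fun _ => x := fun p =>
    ⟨fun h x => h _, fun h b => h (b ())⟩
  rw [isSlender_iff]
  simp only [InfSentence.Holds, slender, torsionFree, reduced, hasFactorialSums, realize_and,
    realize_imp, Realize, huniq, huniq', GroupTerm.realize_nsmul, GroupTerm.realize_zero,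
    GroupTerm.realize_add, GroupTerm.realize_sum, FirstOrder.Language.Term.realize_var,
    Sum.elim_inl, Sum.elim_inr, IsFactorialSum, ← Nat.cast_mul, natCast_zsmul, ne_eq]

end InfFormula

theorem theorem1p8 :
    (∃ Φ : InfSentence.{0, 0, 0} groupVocabulary,
      Φ.InLogic (Order.succ ((2 : Cardinal.{0}) ^ Cardinal.aleph0)) (Cardinal.aleph 1) ∧
        ∀ (G : Type v) [AddCommGroup G], IsSlender G ↔ Φ.Holds G) ∧
      IsAxiomatizable.{v, 0} (Cardinal.aleph 1) (fun (G : Type v) [AddCommGroup G] => IsSlender G) := by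
  have hΦ : ∀ (G : Type v) [AddCommGroup G],
      IsSlender G ↔ InfSentence.Holds InfFormula.slender G :=
    fun G _ => (InfFormula.holds_slender_iff G).symm
  have hκ : Cardinal.aleph0 < (2 : Cardinal.{0}) ^ Cardinal.aleph0 := Cardinal.cantor _
  refine ⟨⟨InfFormula.slender, InfFormula.slender_inLogic, hΦ⟩,
    Order.succ ((2 : Cardinal.{0}) ^ Cardinal.aleph0), hκ.le.trans (Order.le_succ _), ?_,
    InfFormula.slender, InfFormula.slender_inLogic, hΦ⟩
  rw [← Cardinal.succ_aleph0]
  exact Order.succ_le_succ hκ.le
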